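/- Let $M$ be a rational homology 3-sphere, i.e. a connected closed 3-manifold with $H_*(M;\mathbb{Q})\cong H_*(S^3;\mathbb{Q})$, and let $\mathcal{K}$ be a link in $M$ with countably infinitely many tame components, which is admissible: its components generate $H_1(M)=H_1(M;\mathbb{Z})$. Each component $K$ is given a tubular neighbourhood $V_K\cong S^1\times D^2$ (contained in an open tube $S^1\times\mathbb{R}^2$ around $K$), and $v_K:H_1(\partial V_K)\to H_1(V_K)\cong\mathbb{Z}$ is induced by inclusion. Since the tubes may meet other components, $\partial V_K$ is identified, along the rays of the normal discs, with the boundary of an arbitrarily thin tube around $K$ (that is, with the unit normal bundle of $K$). Below, $L$ and $L'$ run through finite sublinks of $\mathcal{K}$. The idele group is $$\mathcal{J}_{M,\mathcal{K}}=\Bigl\{(a_K)_K\in\prod_{K\subset\mathcal{K}}H_1(\partial V_K)\ \Big|\ v_K(a_K)=0\text{ for all but finitely many }K\Bigr\}.$$ Put $H_2(M,\mathcal{K})=\varinjlim_L H_2(M,L)$ and let $\Delta:H_2(M,\mathcal{K})\to\mathcal{J}_{M,\mathcal{K}}$ be the map whose components at the knots of $L'\supseteq L$ are given, on $H_2(M,L)$,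 by $$H_2(M,L)\to H_2(M,V_{L'})\cong H_2(M-\mathrm{Int}\,V_{L'},\partial V_{L'})\xrightarrow{\ \partial\ }H_1(\partial V_{L'})=\bigoplus_{K\subset L'}H_1(\partial V_K),$$ where $V_{L'}$ is the union of disjoint thin tubes around the components of $L'$. Put $\mathcal{P}_{M,\mathcal{K}}=\mathrm{Im}\,\Delta$ and $\mathcal{C}_{M,\mathcal{K}}=\mathcal{J}_{M,\mathcal{K}}/\mathcal{P}_{M,\mathcal{K}}$, and let $\langle\,\cdot\,\rangle_K:H_1(\partial V_K)\hookrightarrow\mathcal{J}_{M,\mathcal{K}}\twoheadrightarrow\mathcal{C}_{M,\mathcal{K}}$ be the natural map. Put $H_1(M-\mathcal{K})=\varprojlim_L H_1(M-L)$. The natural maps $H_1(\partial V_K)\to H_1(M-L)$ induce a homomorphism $\rho:\mathcal{C}_{M,\mathcal{K}}\to H_1(M-\mathcal{K})$. Let $h:N\to M$ be a finite abelian cover branched along a finite sublink $L$ of $\mathcal{K}$, where $N$ is a connected closed 3-manifold: $h$ is a connected finite covering over $M-L$, near each point over $L$ it has the form $(t,z)\mapsto(t,z^e)$ with $e\ge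 1$ and $L=\{z=0\}$, and its group $\mathrm{Gal}(h)$ of covering transformations is abelian and transitive on the fibres over $M-L$. The global norm residue symbol $(\,\cdot\,,h):\mathcal{C}_{M,\mathcal{K}}\to\mathrm{Gal}(h)$ is the composition of $\rho$, the projection $H_1(M-\mathcal{K})\to H_1(M-L)$, and the homomorphism $H_1(M-L)\to\mathrm{Gal}(h)$ that sends the class of a loop $\gamma$ to the covering transformation carrying the initial point of a lift of $\gamma$ to its end point. Let $K$ be a component of $\mathcal{K}$, with $V_K$ so thin that it is disjoint from the components of $L$ other than $K$. Let $h_K:W\to\partial V_K$ be the restriction of $h$ to a connected component $W$ of $h^{-1}(\partial V_K)$. It is an abelian covering, and its local norm residue symbol $(\,\cdot\,,h_K):H_1(\partial V_K)\to\mathrm{Gal}(h_K)$ is defined by lifting loops in the same way. Every covering transformation of $W$ over $\partial V_K$ extends uniquely to an element of $\mathrm{Gal}(h)$; this defines the natural map $\mathrm{Gal}(h_K)\to\mathrm{Gal}(h)$. Then, for every $K$ and every choice of $W$, the following diagram commutes: $$\begin{array}{ccc} H_1(\partial V_K)&\xrightarrow{\ (\,\cdot\,,\,h_K)\ }&\mathrm{Gal}(h_K)\\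 {\scriptstyle\langle\,\cdot\,\rangle_K}\big\downarrow&&\big\downarrow\\ \mathcal{C}_{M,\mathcal{K}}&\xrightarrow{\ (\,\cdot\,,\,h)\ }&\mathrm{Gal}(h). \end{array}$$ That is, for every $a\in H_1(\partial V_K)$, the image of $(a,h_K)$ in $\mathrm{Gal}(h)$ equals $(\langle a\rangle_K,h)$. -/

import Mathlib

open CategoryTheory Limits AlgebraicTopology Topology
open scoped Simplicial

noncomputable section

namespace KnotIdele

/-! ## Singular homology of spaces and of pairs -/

/-- The integral singular chain complex. -/
abbrev singCx : TopCat.{0} ⥤ ChainComplex AddCommGrpCat.{0} ℕ :=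
  (singularChainComplexFunctor AddCommGrpCat.{0}).obj (AddCommGrpCat.of ℤ)

/-- The integral singular homology group `H_n(X)`. -/
abbrev SingH (n : ℕ) (X : Type) [TopologicalSpace X] : AddCommGrpCat.{0} :=
  (singCx.obj (TopCat.of X)).homology n

/-- The map `f_* : H_n(X) → H_n(Y)`. -/
def SingH.map (n : ℕ) {X Y : Type} [TopologicalSpace X] [TopologicalSpace Y] (f : C(X, Y)) :
    SingH n X →+ SingH n Y :=
  (HomologicalComplex.homologyMap (singCx.map (TopCat.ofHom f)) n).hom

lemma SingH.map_comp (n : ℕ) {X Y Z : Type} [TopologicalSpace X] [TopologicalSpace Y]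
    [TopologicalSpace Z] (g : C(Y, Z)) (f : C(X, Y)) :
    SingH.map n (g.comp f) = (SingH.map n g).comp (SingH.map n f) := by
  rw [SingH.map, TopCat.ofHom_comp, Functor.map_comp, HomologicalComplex.homologyMap_comp,
    AddCommGrpCat.hom_comp]
  rfl

lemma SingH.map_homotopic (n : ℕ) {X Y : Type} [TopologicalSpace X] [TopologicalSpace Y]
    {f g : C(X, Y)} (H : f.Homotopic g) : SingH.map n f = SingH.map n g := by
  obtain ⟨H⟩ := H
  exact congrArg AddCommGrpCat.Hom.hom
    (TopCat.Homotopy.congr_homologyMap_singularChainComplexFunctor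
      (f := TopCat.ofHom f) (g := TopCat.ofHom g) H (AddCommGrpCat.of ℤ) n)

/-- The relative singular chain complex `C(X) / C(A)` of a pair `(X, A)`. -/
abbrev relCx (P : TopPair.{0}) : ChainComplex AddCommGrpCat.{0} ℕ := cokernel (singCx.map P.map)

instance singCx_mono (P : TopPair.{0}) : Mono (singCx.map P.map) := by
  have : Mono P.map := (TopCat.mono_iff_injective _).2 P.isEmbedding_map.injective
  infer_instance

lemma relCx_shortExact (P : TopPair.{0}) :
    (ShortComplex.mk (singCx.map P.map) (cokernel.π _) (cokernel.condition _)).ShortExact :=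
  { exact := ShortComplex.exact_cokernel _
    mono_f := inferInstanceAs (Mono (singCx.map P.map))
    epi_g := inferInstanceAs (Epi (cokernel.π _)) }

/-- The relative homology group `H_n(X, A)`. -/
abbrev RelH (n : ℕ) (P : TopPair.{0}) : AddCommGrpCat.{0} := (relCx P).homology n

/-- The map on relative homology induced by a map of pairs. -/
def RelH.map (n : ℕ) {P Q : TopPair.{0}} (f : P ⟶ Q) : RelH n P →+ RelH n Q :=
  (HomologicalComplex.homologyMap
    (cokernel.map (singCx.map P.map) (singCx.map Q.map) (singCx.map (TopPair.Hom.snd f))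
      (singCx.map (TopPair.Hom.fst f)) (by
        rw [← Functor.map_comp, ← Functor.map_comp, TopPair.Hom.w])) n).hom

/-- The connecting homomorphism `∂ : H_{n+1}(X, A) → H_n(A)`. -/
def RelH.boundary (n : ℕ) (P : TopPair.{0}) : RelH (n + 1) P →+ SingH n P.snd :=
  ((relCx_shortExact P).δ (n + 1) n (by simp)).hom

lemma RelH.map_boundary (n : ℕ) (P : TopPair.{0}) (x : RelH (n + 1) P) :
    SingH.map n P.map.hom (RelH.boundary n P x) = 0 :=
  congrArg (fun f => AddCommGrpCat.Hom.hom f x) ((relCx_shortExact P).δ_comp (n + 1) n (by simp))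

/-- The pair `(B, A)` for subsets `A ⊆ B` of a space. -/
def pair {M : Type} [TopologicalSpace M] {A B : Set M} (h : A ⊆ B) : TopPair.{0} :=
  TopPair.of (A := TopCat.of A) (X := TopCat.of B)
    (TopCat.ofHom ⟨Set.inclusion h, continuous_inclusion h⟩) (.inclusion h)

/-- The inclusion of pairs `(B, A) → (B', A')`. -/
def pairIncl {M : Type} [TopologicalSpace M] {A B A' B' : Set M} (h : A ⊆ B) (h' : A' ⊆ B')
    (hA : A ⊆ A') (hB : B ⊆ B') : pair h ⟶ pair h' :=
  TopPair.ofHom (X := pair h) (Y := pair h')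
    (TopCat.ofHom ⟨Set.inclusion hB, continuous_inclusion hB⟩)
    (TopCat.ofHom ⟨Set.inclusion hA, continuous_inclusion hA⟩) rfl

/-- The inclusion of a subset into a larger one, as a continuous map. -/
def setIncl {M : Type} [TopologicalSpace M] {A B : Set M} (h : A ⊆ B) : C(A, B) :=
  ⟨Set.inclusion h, continuous_inclusion h⟩

/-- The connecting homomorphism `∂ : H_{n+1}(B, A) → H_n(A)` for subsets `A ⊆ B` of a space. -/
def pairBoundary (n : ℕ) {M : Type} [TopologicalSpace M] {A B : Set M} (h : A ⊆ B) :
    RelH (n + 1) (pair h) →+ SingH n A :=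
  RelH.boundary n (pair h)

lemma map_pairBoundary (n : ℕ) {M : Type} [TopologicalSpace M] {A B : Set M} (h : A ⊆ B)
    (x : RelH (n + 1) (pair h)) : SingH.map n (setIncl h) (pairBoundary n h x) = 0 :=
  RelH.map_boundary n (pair h) x

lemma pairIncl_comp {M : Type} [TopologicalSpace M] {A B A' B' A'' B'' : Set M} (h : A ⊆ B)
    (h' : A' ⊆ B') (h'' : A'' ⊆ B'') (hA : A ⊆ A') (hB : B ⊆ B') (hA' : A' ⊆ A'')
    (hB' : B' ⊆ B'') : pairIncl h h' hA hB ≫ pairIncl h' h'' hA' hB' =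
      pairIncl h h'' (hA.trans hA') (hB.trans hB') := rfl

lemma RelH.map_comp {P Q R : TopPair.{0}} (n : ℕ) (f : P ⟶ Q) (g : Q ⟶ R) (x : RelH n P) :
    RelH.map n (f ≫ g) x = RelH.map n g (RelH.map n f x) := by
  have h : ∀ (w₁ w₂ w₃), cokernel.map (singCx.map P.map) (singCx.map R.map)
      (singCx.map (TopPair.Hom.snd (f ≫ g))) (singCx.map (TopPair.Hom.fst (f ≫ g))) w₁ =
      cokernel.map (singCx.map P.map) (singCx.map Q.map)
        (singCx.map (TopPair.Hom.snd f)) (singCx.map (TopPair.Hom.fst f)) w₂ ≫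
      cokernel.map (singCx.map Q.map) (singCx.map R.map)
        (singCx.map (TopPair.Hom.snd g)) (singCx.map (TopPair.Hom.fst g)) w₃ := by
    intro w₁ w₂ w₃
    rw [← cancel_epi (cokernel.π _), cokernel.π_desc, cokernel.π_desc_assoc, Category.assoc,
      cokernel.π_desc, ← Category.assoc, ← Functor.map_comp]
    rfl
  rw [RelH.map, h, HomologicalComplex.homologyMap_comp]
  rfl

/-- A rational homology 3-sphere: `H_n(M; ℚ) ≅ H_n(S³; ℚ)` for all `n`. -/
def IsRationalHomologySphere (M : Type) [TopologicalSpace M] : Prop :=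
  ∀ n : ℕ, Nonempty
    (((singularHomologyFunctor (ModuleCat.{0} ℚ) n).obj (ModuleCat.of ℚ ℚ)).obj (TopCat.of M) ≅
      ((singularHomologyFunctor (ModuleCat.{0} ℚ) n).obj (ModuleCat.of ℚ ℚ)).obj
        (TopCat.of (Metric.sphere (0 : EuclideanSpace ℝ (Fin 4)) 1)))

/-! ## The homomorphism `H_1(X) → G` of a regular covering with abelian group `G` -/

/-- The group of covering transformations: homeomorphisms `f` of `E` with `p ∘ f = p`. -/
def Gal {E X : Type} [TopologicalSpace E] (p : E → X) : Subgroup (E ≃ₜ E) where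
  carrier := {f | ∀ e, p (f e) = p e}
  mul_mem' {f g} hf hg e := by rw [Homeomorph.mul_apply, hf, hg]
  one_mem' _ := rfl
  inv_mem' {f} hf e := by rw [← hf (f⁻¹ e), Homeomorph.inv_apply, f.apply_symm_apply]

/-- The properties of a regular covering `p : E → X` with group `G` that the homomorphism
`H_1(X) → G` is built from: `G` acts on `E` over `X`, simply transitively on the fibres, and
singular simplices lift uniquely once one point is lifted. -/
structure IsRegularCover {E X G : Type} [TopologicalSpace E] [TopologicalSpace X] [Group G]
    (p : E → X) (act : G →* (E ≃ₜ E)) : Prop where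
  map_act : ∀ g e, p (act g e) = p e
  existsUnique_act : ∀ e e', p e = p e' → ∃! g, act g e = e'
  existsUnique_lift : ∀ (n : ℕ) (f : C(stdSimplex ℝ (Fin (n + 1)), X)) (a₀) (e₀ : E), p e₀ = f a₀ →
    ∃! F : C(stdSimplex ℝ (Fin (n + 1)), E), F a₀ = e₀ ∧ p ∘ F = f

namespace IsRegularCover

variable {E X G : Type} [TopologicalSpace E] [TopologicalSpace X]

/-- The element `g ∈ G` with `e = g · s(p(e))`, where `s` is a fixed choice of a point in every
nonempty fibre. -/
def coord [Group G] {p : E → X} {act : G →* (E ≃ₜ E)} (hp : IsRegularCover p act) (e : E) : G :=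
  haveI : Nonempty E := ⟨e⟩
  (hp.existsUnique_act (Function.invFun p (p e)) e (Function.invFun_eq ⟨e, rfl⟩)).choose

lemma act_coord [Group G] [Nonempty E] {p : E → X} {act : G →* (E ≃ₜ E)}
    (hp : IsRegularCover p act) (e : E) : act (hp.coord e) (Function.invFun p (p e)) = e :=
  (hp.existsUnique_act (Function.invFun p (p e)) e (Function.invFun_eq ⟨e, rfl⟩)).choose_spec.1

lemma coord_act [Group G] {p : E → X} {act : G →* (E ≃ₜ E)} (hp : IsRegularCover p act) (g : G)
    (e : E) : hp.coord (act g e) = g * hp.coord e := by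
  have : Nonempty E := ⟨e⟩
  have h1 := hp.act_coord (act g e)
  rw [hp.map_act] at h1
  refine (hp.existsUnique_act (Function.invFun p (p e)) (act g e) ?_).unique h1 ?_
  · rw [Function.invFun_eq (f := p) ⟨e, rfl⟩, hp.map_act]
  · rw [map_mul, Homeomorph.mul_apply, hp.act_coord]

/-- The value on a singular 1-simplex `f : Δ¹ → X`: lift `f` to `F` and compare the end points
`F(v₀) = a · s(f(v₀))`, `F(v₁) = b · s(f(v₁))`; the value is `b / a`. On a loop this is the covering
transformation that carries the initial point of a lift to its end point. -/
def edge [CommGroup G] {p : E → X} {act : G →* (E ≃ₜ E)} (hp : IsRegularCover p act)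
    (f : C(stdSimplex ℝ (Fin 2), X)) : Additive G :=
  open Classical in
  if H : ∃ F : C(stdSimplex ℝ (Fin 2), E), p ∘ F = f then
    Additive.ofMul (hp.coord (H.choose (stdSimplex.vertex 1)) /
      hp.coord (H.choose (stdSimplex.vertex 0)))
  else 0

lemma edge_eq [CommGroup G] {p : E → X} {act : G →* (E ≃ₜ E)} (hp : IsRegularCover p act)
    {f : C(stdSimplex ℝ (Fin 2), X)} (F : C(stdSimplex ℝ (Fin 2), E)) (hF : p ∘ F = f) :
    hp.edge f = Additive.ofMul (hp.coord (F (stdSimplex.vertex 1)) /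
      hp.coord (F (stdSimplex.vertex 0))) := by
  have H : ∃ F : C(stdSimplex ℝ (Fin 2), E), p ∘ F = f := ⟨F, hF⟩
  rw [edge, dif_pos H]
  obtain ⟨g, hg, -⟩ := hp.existsUnique_act (F (stdSimplex.vertex 0))
    (H.choose (stdSimplex.vertex 0))
    ((congrFun hF _).trans (congrFun H.choose_spec _).symm)
  let F' : C(stdSimplex ℝ (Fin 2), E) := ⟨fun t => act g (F t), (act g).continuous.comp F.continuous⟩
  have hF' : H.choose = F' := by
    refine (hp.existsUnique_lift 1 f (stdSimplex.vertex 0) _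
      (congrFun H.choose_spec _)).unique ⟨rfl, H.choose_spec⟩ ⟨hg, ?_⟩
    funext t
    exact (hp.map_act g _).trans (congrFun hF t)
  rw [hF']
  change Additive.ofMul (hp.coord (act g _) / hp.coord (act g _)) = _
  rw [hp.coord_act, hp.coord_act, mul_div_mul_left_eq_div]

lemma edge_triangle [CommGroup G] {p : E → X} {act : G →* (E ≃ₜ E)} (hp : IsRegularCover p act)
    (f : C(stdSimplex ℝ (Fin 3), X)) (f₀ f₁ f₂ : C(stdSimplex ℝ (Fin 2), X))
    (h₀ : ∀ t, f₀ t = f (stdSimplex.map (Fin.succAbove 0) t))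
    (h₁ : ∀ t, f₁ t = f (stdSimplex.map (Fin.succAbove 1) t))
    (h₂ : ∀ t, f₂ t = f (stdSimplex.map (Fin.succAbove 2) t)) :
    hp.edge f₀ - hp.edge f₁ + hp.edge f₂ = 0 := by
  by_cases H : ∃ F : C(stdSimplex ℝ (Fin 3), E), p ∘ F = f
  · obtain ⟨F, hF⟩ := H
    have key : ∀ (i : Fin 3) (fi : C(stdSimplex ℝ (Fin 2), X))
        (_ : ∀ t, fi t = f (stdSimplex.map (Fin.succAbove i) t)),
        hp.edge fi = Additive.ofMul
          (hp.coord (F (stdSimplex.vertex (Fin.succAbove i 1))) /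
            hp.coord (F (stdSimplex.vertex (Fin.succAbove i 0)))) := by
      intro i fi hi
      have := hp.edge_eq (f := fi)
        (F.comp ⟨stdSimplex.map (Fin.succAbove i), stdSimplex.continuous_map _⟩) (by
          funext t
          rw [hi]
          exact congrFun hF _)
      rw [this]
      simp only [ContinuousMap.comp_apply, ContinuousMap.coe_mk, stdSimplex.map_vertex]
    rw [key 0 f₀ h₀, key 1 f₁ h₁, key 2 f₂ h₂]
    have e00 : Fin.succAbove (0 : Fin 3) (0 : Fin 2) = 1 := rfl
    have e01 : Fin.succAbove (0 : Fin 3) (1 : Fin 2) = 2 := rfl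
    have e10 : Fin.succAbove (1 : Fin 3) (0 : Fin 2) = 0 := rfl
    have e11 : Fin.succAbove (1 : Fin 3) (1 : Fin 2) = 2 := rfl
    have e20 : Fin.succAbove (2 : Fin 3) (0 : Fin 2) = 0 := rfl
    have e21 : Fin.succAbove (2 : Fin 3) (1 : Fin 2) = 1 := rfl
    rw [e00, e01, e10, e11, e20, e21]
    simp only [ofMul_div]
    abel
  · have key : ∀ (i : Fin 3) (fi : C(stdSimplex ℝ (Fin 2), X))
        (_ : ∀ t, fi t = f (stdSimplex.map (Fin.succAbove i) t)), hp.edge fi = 0 := by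
      intro i fi hi
      rw [edge, dif_neg]
      rintro ⟨F, hF⟩
      obtain ⟨F', hF', -⟩ := hp.existsUnique_lift 2 f
        (stdSimplex.map (Fin.succAbove i) (stdSimplex.vertex 0)) (F (stdSimplex.vertex 0))
        ((congrFun hF _).trans (hi _))
      exact H ⟨F', hF'.2⟩
    rw [key 0 f₀ h₀, key 1 f₁ h₁, key 2 f₂ h₂]
    simp

/-- The homomorphism `C_1(X) → G` on singular 1-chains with the values `edge`. -/
def chainHom [CommGroup G] {p : E → X} {act : G →* (E ≃ₜ E)} (hp : IsRegularCover p act) :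
    ((TopCat.toSSet.obj (TopCat.of X)).chainComplex (AddCommGrpCat.of ℤ)).X 1 ⟶
      AddCommGrpCat.of (Additive G) :=
  Cofan.IsColimit.desc ((TopCat.toSSet.obj (TopCat.of X)).isColimitChainComplexXCofan
      (AddCommGrpCat.of ℤ) 1)
    (fun σ => AddCommGrpCat.ofHom
      (zmultiplesHom (Additive G) (hp.edge ((TopCat.of X).toSSetObjEquiv _ σ))))

lemma d_chainHom [CommGroup G] {p : E → X} {act : G →* (E ≃ₜ E)} (hp : IsRegularCover p act) :
    ((TopCat.toSSet.obj (TopCat.of X)).chainComplex (AddCommGrpCat.of ℤ)).d 2 1 ≫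
      hp.chainHom = 0 := by
  have hι : ∀ σ : (TopCat.toSSet.obj (TopCat.of X)) _⦋1⦌,
      (TopCat.toSSet.obj (TopCat.of X)).ιChainComplex (R := AddCommGrpCat.of ℤ) σ ≫
        hp.chainHom = AddCommGrpCat.ofHom
      (zmultiplesHom (Additive G) (hp.edge ((TopCat.of X).toSSetObjEquiv _ σ))) := fun σ =>
    Cofan.IsColimit.fac ((TopCat.toSSet.obj (TopCat.of X)).isColimitChainComplexXCofan
      (AddCommGrpCat.of ℤ) 1) _ σ
  refine SSet.chainComplex_hom_ext (X := TopCat.toSSet.obj (TopCat.of X)) fun σ => ?_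
  rw [SSet.ιChainComplex_d_assoc]
  rw [Fin.sum_univ_three]
  simp only [Preadditive.add_comp, Preadditive.zsmul_comp, hι, comp_zero]
  have := hp.edge_triangle ((TopCat.of X).toSSetObjEquiv _ σ)
    ((TopCat.of X).toSSetObjEquiv _ ((TopCat.toSSet.obj (TopCat.of X)).δ 0 σ))
    ((TopCat.of X).toSSetObjEquiv _ ((TopCat.toSSet.obj (TopCat.of X)).δ 1 σ))
    ((TopCat.of X).toSSetObjEquiv _ ((TopCat.toSSet.obj (TopCat.of X)).δ 2 σ))
    (fun t => rfl) (fun t => rfl) (fun t => rfl)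
  refine AddCommGrpCat.hom_ext (AddMonoidHom.ext_int ?_)
  simpa [sub_eq_add_neg] using this

/-- The homomorphism `H_1(X) → G` of a regular covering of `X` with abelian group `G`: the class of
a loop `γ` goes to the covering transformation that carries the initial point of a lift of `γ` to
its end point. -/
def holonomy [CommGroup G] {p : E → X} {act : G →* (E ≃ₜ E)} (hp : IsRegularCover p act) :
    SingH 1 X →+ Additive G :=
  ((singCx.obj (TopCat.of X)).homologyι 1 ≫
    (singCx.obj (TopCat.of X)).descOpcycles hp.chainHom 2 (by simp) hp.d_chainHom).hom

end IsRegularCover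

/-! ## Links and their tubular neighbourhoods -/

/-- A link in `M` with tame components indexed by `ι`, together with a tubular neighbourhood of each
component: pairwise disjoint knots `K_i = tube i (S¹ × {0})`, where `tube i` is a homeomorphism of
`S¹ × ℂ` onto an open subset of `M`. The tubes of different components may intersect, so the union
of all components need not be closed. -/
structure TubedLink (ι : Type*) (M : Type) [TopologicalSpace M] where
  tube : ι → Circle × ℂ → M
  isOpenEmbedding_tube : ∀ i, IsOpenEmbedding (tube i)
  disjoint_core : ∀ i j, i ≠ j → ∀ u v, tube i (u, 0) ≠ tube j (v, 0)

namespace TubedLink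

variable {ι : Type*} {M : Type} [TopologicalSpace M]

/-- The knot `K_i`, as a parametrized closed curve. -/
def knot (K : TubedLink ι M) (i : ι) : C(Circle, M) :=
  ⟨fun u => K.tube i (u, 0), (K.isOpenEmbedding_tube i).continuous.comp (by fun_prop)⟩

/-- The solid torus of radius `r` around `K_i`; the tubular neighbourhood `V_i` is the one of
radius 1. -/
def solid (K : TubedLink ι M) (i : ι) (r : ℝ) : Set M := K.tube i '' {p | ‖p.2‖ ≤ r}

/-- The boundary torus of the solid torus of radius `r` around `K_i`; `∂V_i` is the one of
radius 1. -/
def torus (K : TubedLink ι M) (i : ι) (r : ℝ) : Set M := K.tube i '' {p | ‖p.2‖ = r}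

/-- The union `L` of the components with index in the finite set `S`. -/
def sublink (K : TubedLink ι M) (S : Finset ι) : Set M := ⋃ i ∈ S, Set.range (K.knot i)

/-- The complement `M - L` of a finite sublink. -/
def compl (K : TubedLink ι M) (S : Finset ι) : Set M := (K.sublink S)ᶜ

/-- The components generate `H_1(M)`. -/
def IsAdmissible (K : TubedLink ι M) : Prop :=
  ⨆ i, (SingH.map 1 (K.knot i)).range = ⊤

lemma torus_subset_solid (K : TubedLink ι M) (i : ι) (r : ℝ) : K.torus i r ⊆ K.solid i r :=
  Set.image_mono fun _ hp => le_of_eq hp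

lemma tube_mem_solid (K : TubedLink ι M) {i : ι} {r : ℝ} {p : Circle × ℂ} :
    K.tube i p ∈ K.solid i r ↔ ‖p.2‖ ≤ r :=
  (K.isOpenEmbedding_tube i).injective.mem_set_image

lemma tube_mem_torus (K : TubedLink ι M) {i : ι} {r : ℝ} {p : Circle × ℂ} :
    K.tube i p ∈ K.torus i r ↔ ‖p.2‖ = r :=
  (K.isOpenEmbedding_tube i).injective.mem_set_image

lemma solid_subset_range (K : TubedLink ι M) (i : ι) (r : ℝ) :
    K.solid i r ⊆ Set.range (K.tube i) := Set.image_subset_range _ _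

/-- The fibrewise dilation `tube i (u, z) ↦ tube i (u, r z)`, from `A` to `B`. -/
def dilation (K : TubedLink ι M) (i : ι) (r : ℝ) {A B : Set M} (hA : A ⊆ Set.range (K.tube i))
    (hB : ∀ p, K.tube i p ∈ A → K.tube i (p.1, r * p.2) ∈ B) : C(A, B) where
  toFun x :=
    ⟨K.tube i ((((K.isOpenEmbedding_tube i).isEmbedding.toHomeomorph.symm ⟨x, hA x.2⟩).1,
      r * ((K.isOpenEmbedding_tube i).isEmbedding.toHomeomorph.symm ⟨x, hA x.2⟩).2)), by
      obtain ⟨p, hp⟩ := hA x.2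
      have h : (K.isOpenEmbedding_tube i).isEmbedding.toHomeomorph.symm ⟨x, hA x.2⟩ = p := by
        rw [Homeomorph.symm_apply_eq]
        exact Subtype.ext hp.symm
      rw [h]
      exact hB p (hp ▸ x.2)⟩
  continuous_toFun := by
    refine Continuous.subtype_mk ((K.isOpenEmbedding_tube i).continuous.comp ?_) _
    have h : Continuous fun x : A =>
        (K.isOpenEmbedding_tube i).isEmbedding.toHomeomorph.symm ⟨x, hA x.2⟩ :=
      (Homeomorph.continuous _).comp (Continuous.subtype_mk continuous_subtype_val _)
    fun_prop

lemma dilation_apply (K : TubedLink ι M) (i : ι) (r : ℝ) {A B : Set M}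
    (hA : A ⊆ Set.range (K.tube i))
    (hB : ∀ p, K.tube i p ∈ A → K.tube i (p.1, r * p.2) ∈ B) (p) (hp : K.tube i p ∈ A) :
    (K.dilation i r hA hB ⟨K.tube i p, hp⟩ : M) = K.tube i (p.1, r * p.2) := by
  have h : (K.isOpenEmbedding_tube i).isEmbedding.toHomeomorph.symm ⟨K.tube i p, hA hp⟩ = p := by
    rw [Homeomorph.symm_apply_eq]
    rfl
  change K.tube i (_, _) = _
  rw [h]

lemma dilation_homotopic (K : TubedLink ι M) (i : ι) (r r' : ℝ) {A B : Set M}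
    (hA : A ⊆ Set.range (K.tube i))
    (hB : ∀ p, K.tube i p ∈ A → K.tube i (p.1, r * p.2) ∈ B)
    (hB' : ∀ p, K.tube i p ∈ A → K.tube i (p.1, r' * p.2) ∈ B)
    (H : ∀ t ∈ Set.Icc (0 : ℝ) 1, ∀ p, K.tube i p ∈ A →
      K.tube i (p.1, ((1 - t) * r + t * r' : ℝ) * p.2) ∈ B) :
    (K.dilation i r hA hB).Homotopic (K.dilation i r' hA hB') := by
  have hH : ∀ (t : unitInterval) (x : A),
      K.tube i ((((K.isOpenEmbedding_tube i).isEmbedding.toHomeomorph.symm ⟨x, hA x.2⟩).1,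
      ((1 - t) * r + t * r' : ℝ) *
        ((K.isOpenEmbedding_tube i).isEmbedding.toHomeomorph.symm ⟨x, hA x.2⟩).2)) ∈ B := by
    intro t x
    obtain ⟨p, hp⟩ := hA x.2
    have h : (K.isOpenEmbedding_tube i).isEmbedding.toHomeomorph.symm ⟨x, hA x.2⟩ = p := by
      rw [Homeomorph.symm_apply_eq]
      exact Subtype.ext hp.symm
    rw [h]
    exact H t t.2 p (hp ▸ x.2)
  refine ⟨⟨⟨fun q => ⟨_, hH q.1 q.2⟩, ?_⟩, ?_, ?_⟩⟩
  · refine Continuous.subtype_mk ((K.isOpenEmbedding_tube i).continuous.comp ?_) _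
    have h : Continuous fun q : unitInterval × A =>
        (K.isOpenEmbedding_tube i).isEmbedding.toHomeomorph.symm ⟨q.2, hA q.2.2⟩ :=
      (Homeomorph.continuous _).comp
        (Continuous.subtype_mk (continuous_subtype_val.comp continuous_snd) _)
    fun_prop
  · intro x
    refine Subtype.ext ?_
    change K.tube i _ = K.tube i _
    simp
  · intro x
    refine Subtype.ext ?_
    change K.tube i _ = K.tube i _
    simp

lemma eventually_solid_subset (K : TubedLink ι M) (i : ι) {U : Set M} (hU : IsOpen U)
    (h : Set.range (K.knot i) ⊆ U) : ∀ᶠ r in 𝓝[>] (0 : ℝ), K.solid i r ⊆ U := by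
  have hU' : IsOpen (K.tube i ⁻¹' U) := hU.preimage (K.isOpenEmbedding_tube i).continuous
  obtain ⟨u, v, -, hv, hu, h0, huv⟩ := generalized_tube_lemma
    (isCompact_univ (X := Circle)) (isCompact_singleton (x := (0 : ℂ))) hU' (by
      rintro ⟨a, b⟩ ⟨-, rfl⟩
      exact h ⟨a, rfl⟩)
  obtain ⟨ε, hε, hball⟩ := Metric.isOpen_iff.1 hv 0 (h0 rfl)
  filter_upwards [Ioo_mem_nhdsGT hε] with r hr
  rintro _ ⟨p, hp, rfl⟩
  refine huv (a := p) ⟨hu trivial, hball ?_⟩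
  rw [mem_ball_zero_iff]
  exact lt_of_le_of_lt hp hr.2

lemma isCompact_knot (K : TubedLink ι M) (i : ι) : IsCompact (Set.range (K.knot i)) :=
  isCompact_range (K.knot i).continuous

lemma disjoint_knot (K : TubedLink ι M) {i j : ι} (h : i ≠ j) :
    Disjoint (Set.range (K.knot i)) (Set.range (K.knot j)) := by
  rw [Set.disjoint_left]
  rintro _ ⟨u, rfl⟩ ⟨v, hv⟩
  exact K.disjoint_core i j h u v hv.symm

/-- The solid torus of radius `r > 0` around `K_i` is disjoint from all components `K_j ≠ K_i`
with `j ∈ S`. -/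
def IsSmall (K : TubedLink ι M) (S : Finset ι) (i : ι) (r : ℝ) : Prop :=
  0 < r ∧ ∀ j ∈ S, j ≠ i → Disjoint (K.solid i r) (Set.range (K.knot j))

lemma exists_isSmall [T2Space M] (K : TubedLink ι M) (S : Finset ι) (i : ι) :
    ∃ r, K.IsSmall S i r := by
  have h : ∀ j ∈ S, ∀ᶠ r in 𝓝[>] (0 : ℝ),
      j ≠ i → Disjoint (K.solid i r) (Set.range (K.knot j)) := by
    intro j _
    by_cases hji : j = i
    · simp [hji]
    · filter_upwards [K.eventually_solid_subset i (K.isCompact_knot j).isClosed.isOpen_compl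
        (K.disjoint_knot (Ne.symm hji)).subset_compl_right] with r hr _
      exact Set.disjoint_left.2 fun x hx => hr hx
  obtain ⟨r, h1, h2⟩ :=
    (((S.eventually_all).2 h).and (self_mem_nhdsWithin (a := (0 : ℝ)) (s := Set.Ioi 0))).exists
  exact ⟨r, h2, h1⟩

/-- The solid tori of radius `r > 0` around the components with index in `S` are pairwise
disjoint. -/
def TubesDisjoint (K : TubedLink ι M) (S : Finset ι) (r : ℝ) : Prop :=
  0 < r ∧ ∀ i ∈ S, ∀ j ∈ S, i ≠ j → Disjoint (K.solid i r) (K.solid j r)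

lemma exists_tubesDisjoint [T2Space M] (K : TubedLink ι M) (S : Finset ι) :
    ∃ r, K.TubesDisjoint S r := by
  have h : ∀ i ∈ S, ∀ j ∈ S, ∀ᶠ r in 𝓝[>] (0 : ℝ),
      i ≠ j → Disjoint (K.solid i r) (K.solid j r) := by
    intro i _ j _
    by_cases hij : i = j
    · simp [hij]
    · obtain ⟨U, V, hU, hV, hiU, hjV, hUV⟩ :=
        SeparatedNhds.of_isCompact_isCompact (K.isCompact_knot i) (K.isCompact_knot j)
          (K.disjoint_knot hij)
      filter_upwards [K.eventually_solid_subset i hU hiU, K.eventually_solid_subset j hV hjV]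
        with r h1 h2 _
      exact hUV.mono h1 h2
  obtain ⟨r, h1, h2⟩ := (((S.eventually_all).2 fun i hi => (S.eventually_all).2 (h i hi)).and
    (self_mem_nhdsWithin (a := (0 : ℝ)) (s := Set.Ioi 0))).exists
  exact ⟨r, h2, h1⟩

lemma TubesDisjoint.isSmall {K : TubedLink ι M} {S : Finset ι} {r : ℝ} (h : K.TubesDisjoint S r)
    {i : ι} (hi : i ∈ S) {S' : Finset ι} (hS : S' ⊆ S) : K.IsSmall S' i r :=
  ⟨h.1, fun j hj hji => (h.2 i hi j (hS hj) (Ne.symm hji)).mono_right (by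
    rintro _ ⟨u, rfl⟩
    exact ⟨(u, 0), by simpa using h.1.le, rfl⟩)⟩

lemma mem_compl_of_isSmall (K : TubedLink ι M) {S : Finset ι} {i : ι} {r : ℝ}
    (hr : K.IsSmall S i r) {p : Circle × ℂ} (hp : ‖p.2‖ ≤ r) (h : i ∈ S → p.2 ≠ 0) :
    K.tube i p ∈ K.compl S := by
  intro hx
  obtain ⟨j, hj, u, hu⟩ := Set.mem_iUnion₂.1 hx
  by_cases hji : j = i
  · subst hji
    have := (K.isOpenEmbedding_tube j).injective hu
    exact h hj (by rw [← this])
  · exact Set.disjoint_left.1 (hr.2 j hj hji) ⟨p, hp, rfl⟩ ⟨u, hu⟩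

lemma torus_subset_compl (K : TubedLink ι M) {S : Finset ι} {i : ι} {r : ℝ}
    (hr : K.IsSmall S i r) : K.torus i r ⊆ K.compl S := by
  rintro _ ⟨p, hp, rfl⟩
  refine K.mem_compl_of_isSmall hr (le_of_eq hp) fun _ h0 => ?_
  have : ‖p.2‖ = r := hp
  rw [h0, norm_zero] at this
  exact hr.1.ne this

/-- The homeomorphism `∂V_i → torus of radius r` along the rays of the normal discs. -/
def shrinkTorus (K : TubedLink ι M) (i : ι) {r : ℝ} (hr : 0 < r) : C(K.torus i 1, K.torus i r) :=
  K.dilation i r ((K.torus_subset_solid i 1).trans (K.solid_subset_range i 1)) fun p hp => by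
    rw [tube_mem_torus] at hp ⊢
    rw [norm_mul, hp, mul_one, Complex.norm_real, Real.norm_of_nonneg hr.le]

/-- The map `∂V_i → M - L` that shrinks `∂V_i` to a small torus around `K_i`. -/
def torusToCompl (K : TubedLink ι M) {S : Finset ι} {i : ι} {r : ℝ} (hr : K.IsSmall S i r) :
    C(K.torus i 1, K.compl S) :=
  (setIncl (K.torus_subset_compl hr)).comp (K.shrinkTorus i hr.1)

lemma torusToCompl_homotopic (K : TubedLink ι M) {S : Finset ι} {i : ι} {r r' : ℝ}
    (hr : K.IsSmall S i r) (hr' : K.IsSmall S i r') :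
    (K.torusToCompl hr).Homotopic (K.torusToCompl hr') := by
  have key : ∀ s : ℝ, 0 < s → s ≤ max r r' → ∀ p, K.tube i p ∈ K.torus i 1 →
      K.tube i (p.1, s * p.2) ∈ K.compl S := by
    intro s hs hs' p hp
    rw [tube_mem_torus] at hp
    have hn : ‖(s : ℂ) * p.2‖ = s := by
      rw [norm_mul, hp, mul_one, Complex.norm_real, Real.norm_of_nonneg hs.le]
    have h0 : (s : ℂ) * p.2 ≠ 0 := by
      rw [← norm_pos_iff, hn]
      exact hs
    rcases le_max_iff.1 hs' with h | h
    · exact K.mem_compl_of_isSmall hr (p := (p.1, s * p.2)) (hn.le.trans h) fun _ => h0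
    · exact K.mem_compl_of_isSmall hr' (p := (p.1, s * p.2)) (hn.le.trans h) fun _ => h0
  exact K.dilation_homotopic i r r'
    ((K.torus_subset_solid i 1).trans (K.solid_subset_range i 1)) (key r hr.1 (le_max_left _ _))
    (key r' hr'.1 (le_max_right _ _)) fun t ht => key _ (by
      rcases eq_or_lt_of_le ht.1 with h | h
      · rw [← h]
        simpa using hr.1
      · have h1 := mul_pos h hr'.1
        have h2 := mul_nonneg (sub_nonneg.2 ht.2) hr.1.le
        linarith) (by
      have h1 := mul_le_mul_of_nonneg_left (le_max_left r r') (sub_nonneg.2 ht.2)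
      have h2 := mul_le_mul_of_nonneg_left (le_max_right r r') ht.1
      linarith)

/-! ## Ideles -/

/-- The map `v_i : H_1(∂V_i) → H_1(V_i) ≅ ℤ`. -/
def val (K : TubedLink ι M) (i : ι) : SingH 1 (K.torus i 1) →+ SingH 1 (K.solid i 1) :=
  SingH.map 1 (setIncl (K.torus_subset_solid i 1))

/-- The idele group: the families `(a_i) ∈ ∏ H_1(∂V_i)` with `v_i(a_i) = 0` for all but finitely
many `i`. -/
def ideleGroup (K : TubedLink ι M) : AddSubgroup (∀ i, SingH 1 (K.torus i 1)) where
  carrier := {a | {i | K.val i (a i) ≠ 0}.Finite}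
  zero_mem' := by simp
  add_mem' {a b} ha hb := (ha.union hb).subset fun i hi => by
    by_contra h
    simp only [Set.mem_union, Set.mem_ofPred_eq, not_or, not_not] at h
    exact hi (by rw [Pi.add_apply, map_add, h.1, h.2, add_zero])
  neg_mem' {a} ha := by simpa using ha

/-- The natural map `H_1(∂V_i) → H_1(M - L)`. -/
def toCompl [T2Space M] (K : TubedLink ι M) (S : Finset ι) (i : ι) :
    SingH 1 (K.torus i 1) →+ SingH 1 (K.compl S) :=
  SingH.map 1 (K.torusToCompl (K.exists_isSmall S i).choose_spec)

lemma toCompl_eq [T2Space M] (K : TubedLink ι M) {S : Finset ι} {i : ι} {r : ℝ}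
    (hr : K.IsSmall S i r) : K.toCompl S i = SingH.map 1 (K.torusToCompl hr) :=
  SingH.map_homotopic 1 (K.torusToCompl_homotopic _ hr)

lemma toCompl_eq_zero [T2Space M] (K : TubedLink ι M) {S : Finset ι} {i : ι} (hi : i ∉ S)
    {a : SingH 1 (K.torus i 1)} (ha : K.val i a = 0) : K.toCompl S i a = 0 := by
  obtain ⟨r, hr⟩ := K.exists_isSmall S i
  have h : K.torusToCompl hr = (K.dilation i r (K.solid_subset_range i 1) (B := K.compl S)
      fun p hp => by
        rw [tube_mem_solid] at hp
        refine K.mem_compl_of_isSmall hr (p := (p.1, r * p.2)) ?_ fun h => absurd h hi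
        rw [norm_mul, Complex.norm_real, Real.norm_of_nonneg hr.1.le]
        exact mul_le_of_le_one_right hr.1.le hp).comp (setIncl (K.torus_subset_solid i 1)) := rfl
  rw [K.toCompl_eq hr, h, SingH.map_comp]
  exact (congrArg (SingH.map 1 (K.dilation i r _ _)) ha).trans (map_zero _)

/-- The natural map from the idele group to `H_1(M - L)`, `(a_i) ↦ ∑ᵢ (image of a_i)`. The sum is
finite, because `a_i` dies in `H_1(M - L)` if `K_i` is not in `L` and `v_i(a_i) = 0`. -/
def ideleToCompl [T2Space M] (K : TubedLink ι M) (S : Finset ι) :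
    K.ideleGroup →+ SingH 1 (K.compl S) where
  toFun a := ∑ᶠ i, K.toCompl S i (a.1 i)
  map_zero' := by simp
  map_add' a b := by
    have hfin : ∀ c : K.ideleGroup,
        (Function.support fun i => K.toCompl S i (c.1 i)).Finite := fun c =>
      (c.2.union S.finite_toSet).subset fun i hi => by
        by_contra h
        simp only [Set.mem_union, Set.mem_ofPred_eq, not_or, not_not] at h
        exact hi (K.toCompl_eq_zero h.2 h.1)
    rw [← finsum_add_distrib (hfin a) (hfin b)]
    exact finsum_congr fun i => map_add _ _ _

lemma compl_anti (K : TubedLink ι M) {S S' : Finset ι} (hS : S ⊆ S') :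
    K.compl S' ⊆ K.compl S :=
  Set.compl_subset_compl.2 (Set.biUnion_subset_biUnion_left hS)

/-- The map `H_1(M - L') → H_1(M - L)` for `L ⊆ L'`. -/
def restr (K : TubedLink ι M) {S S' : Finset ι} (hS : S ⊆ S') :
    SingH 1 (K.compl S') →+ SingH 1 (K.compl S) :=
  SingH.map 1 (setIncl (K.compl_anti hS))

lemma restr_toCompl [T2Space M] (K : TubedLink ι M) {S S' : Finset ι} (hS : S ⊆ S') (i : ι)
    (a : SingH 1 (K.torus i 1)) : K.restr hS (K.toCompl S' i a) = K.toCompl S i a := by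
  obtain ⟨r, hr⟩ := K.exists_isSmall S' i
  have hr' : K.IsSmall S i r := ⟨hr.1, fun j hj => hr.2 j (hS hj)⟩
  rw [K.toCompl_eq hr, K.toCompl_eq hr']
  exact (DFunLike.congr_fun (SingH.map_comp 1 (setIncl (K.compl_anti hS)) (K.torusToCompl hr))
    a).symm

/-- The group `H_1(M - 𝒦)`, the inverse limit of the groups `H_1(M - L)` over the finite sublinks
`L`. -/
def H1Compl (K : TubedLink ι M) : AddSubgroup (∀ S : Finset ι, SingH 1 (K.compl S)) where
  carrier := {c | ∀ (S S' : Finset ι) (hS : S ⊆ S'), K.restr hS (c S') = c S}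
  zero_mem' _ _ _ := map_zero _
  add_mem' {c d} hc hd S S' hS := by
    rw [Pi.add_apply, map_add, hc S S' hS, hd S S' hS, Pi.add_apply]
  neg_mem' {c} hc S S' hS := by
    rw [Pi.neg_apply, map_neg, hc S S' hS, Pi.neg_apply]

/-- The homomorphism `𝒥 → H_1(M - 𝒦)`. -/
def rho [T2Space M] (K : TubedLink ι M) : K.ideleGroup →+ K.H1Compl where
  toFun a := ⟨fun S => K.ideleToCompl S a, fun S S' hS => by
    change K.restr hS (∑ᶠ i, K.toCompl S' i (a.1 i)) = ∑ᶠ i, K.toCompl S i (a.1 i)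
    rw [AddMonoidHom.map_finsum]
    · exact finsum_congr fun i => K.restr_toCompl hS i _
    · refine (a.2.union S'.finite_toSet).subset fun i hi => ?_
      by_contra h
      simp only [Set.mem_union, Set.mem_ofPred_eq, not_or, not_not] at h
      exact hi (K.toCompl_eq_zero h.2 h.1)⟩
  map_zero' := Subtype.ext (funext fun _ => map_zero _)
  map_add' _ _ := Subtype.ext (funext fun _ => map_add _ _ _)

/-- The projection `H_1(M - 𝒦) → H_1(M - L)`. -/
def projCompl (K : TubedLink ι M) (S : Finset ι) : K.H1Compl →+ SingH 1 (K.compl S) where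
  toFun c := c.1 S
  map_zero' := rfl
  map_add' _ _ := rfl

/-! ## Principal ideles -/

/-- The union of the solid tori of radius `r` around the components with index in `S`. -/
def solids (K : TubedLink ι M) (S : Finset ι) (r : ℝ) : Set M := ⋃ i ∈ S, K.solid i r

/-- The union of the tori of radius `r` around the components with index in `S`. -/
def tori (K : TubedLink ι M) (S : Finset ι) (r : ℝ) : Set M := ⋃ i ∈ S, K.torus i r

/-- The exterior of the components with index in `S`: the complement of the open solid tori of
radius `r` around them. -/
def exterior (K : TubedLink ι M) (S : Finset ι) (r : ℝ) : Set M :=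
  (⋃ i ∈ S, K.tube i '' {p | ‖p.2‖ < r})ᶜ

lemma sublink_subset_solids (K : TubedLink ι M) {S S' : Finset ι} (hS : S ⊆ S') {r : ℝ}
    (hr : 0 < r) : K.sublink S ⊆ K.solids S' r := by
  refine Set.iUnion₂_subset fun i hi => ?_
  rintro _ ⟨u, rfl⟩
  exact Set.mem_iUnion₂.2 ⟨i, hS hi, (u, 0), by simpa using hr.le, rfl⟩

lemma sublink_mono (K : TubedLink ι M) {S S' : Finset ι} (hS : S ⊆ S') :
    K.sublink S ⊆ K.sublink S' :=
  Set.biUnion_subset_biUnion_left hS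

lemma tori_subset_solids (K : TubedLink ι M) (S : Finset ι) (r : ℝ) :
    K.tori S r ⊆ K.solids S r :=
  Set.iUnion₂_mono fun i _ => K.torus_subset_solid i r

lemma tori_subset_exterior (K : TubedLink ι M) {S : Finset ι} {r : ℝ} (h : K.TubesDisjoint S r) :
    K.tori S r ⊆ K.exterior S r := by
  refine Set.iUnion₂_subset fun i hi => ?_
  rintro _ ⟨p, hp, rfl⟩ hx
  obtain ⟨j, hj, q, hq, hqp⟩ := Set.mem_iUnion₂.1 hx
  by_cases hij : i = j
  · subst hij
    rw [(K.isOpenEmbedding_tube i).injective hqp] at hq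
    exact absurd hp (ne_of_lt hq)
  · exact Set.disjoint_left.1 (h.2 i hi j hj hij) ⟨p, le_of_eq hp, rfl⟩
      ⟨q, le_of_lt (show ‖q.2‖ < r from hq), hqp⟩

lemma exterior_subset_compl (K : TubedLink ι M) {S S' : Finset ι} (hS : S' ⊆ S) {r : ℝ} (hr : 0 < r) :
    K.exterior S r ⊆ K.compl S' := by
  refine Set.compl_subset_compl.2 (Set.iUnion₂_subset fun i hi => ?_)
  rintro _ ⟨u, rfl⟩
  exact Set.mem_iUnion₂.2 ⟨i, hS hi, (u, 0), by simpa using hr, rfl⟩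

/-- The map `H_1(∂V_i) → H_1(∂V_L)` for `K_i` in `L`, with tubes of radius `r`. -/
def toTori (K : TubedLink ι M) {S : Finset ι} {r : ℝ} (hr : 0 < r) (i : S) :
    SingH 1 (K.torus i 1) →+ SingH 1 (K.tori S r) :=
  SingH.map 1 ((setIncl (Set.subset_biUnion_of_mem (u := fun i => K.torus i r) i.2)).comp
    (K.shrinkTorus i hr))

/-- The homology `H_2(M, L)` of `M` relative to a finite sublink. -/
abbrev H2Rel (K : TubedLink ι M) (S : Finset ι) : AddCommGrpCat.{0} :=
  RelH 2 (pair (Set.subset_univ (K.sublink S)))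

/-- `a` is the image of `s ∈ H_2(M, L)` under the diagonal map `Δ = ∏ᵢ pr_i ∘ ∂`: for every finite
sublink `L' ⊇ L`, with tubular neighbourhood `V = V_{L'}`, the components of `a` at `L'` are those
of `∂x ∈ H_1(∂V) = ⨁ H_1(∂V_i)`, where `x` corresponds to `s` under
`H_2(M, L) → H_2(M, V) ≅ H_2(M - Int V, ∂V)`. (The last map is the excision isomorphism; thin enough
tubes of the components of `L'` are disjoint.) -/
def IsDiagonal (K : TubedLink ι M) (S : Finset ι) (s : K.H2Rel S)
    (a : ∀ i, SingH 1 (K.torus i 1)) : Prop :=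
  ∀ (S' : Finset ι) (hS : S ⊆ S') (r : ℝ) (hr : K.TubesDisjoint S' r),
    ∃ x : RelH 2 (pair (K.tori_subset_exterior hr)),
      RelH.map 2 (pairIncl (K.tori_subset_exterior hr) (Set.subset_univ (K.solids S' r))
          (K.tori_subset_solids S' r) (Set.subset_univ _)) x =
        RelH.map 2 (pairIncl (Set.subset_univ (K.sublink S)) (Set.subset_univ (K.solids S' r))
          (K.sublink_subset_solids hS hr.1) subset_rfl) s ∧
      pairBoundary 1 (K.tori_subset_exterior hr) x =
        ∑ i : S', K.toTori hr.1 i (a i)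

/-- The group of principal ideles, the image of `Δ : H_2(M, 𝒦) → 𝒥`, where `H_2(M, 𝒦)` is the direct
limit of the groups `H_2(M, L)` over the finite sublinks `L`. -/
def principalIdeles (K : TubedLink ι M) : AddSubgroup K.ideleGroup where
  carrier := {a | ∃ (S : Finset ι) (s : K.H2Rel S), K.IsDiagonal S s a.1}
  zero_mem' := ⟨∅, 0, fun S' hS r hr => ⟨0, by rw [map_zero, map_zero], by
    rw [map_zero]
    exact (Finset.sum_eq_zero fun i _ => map_zero _).symm⟩⟩
  neg_mem' := by
    rintro a ⟨S, s, h⟩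
    refine ⟨S, -s, fun S' hS r hr => ?_⟩
    obtain ⟨x, hx, hx'⟩ := h S' hS r hr
    refine ⟨-x, by rw [map_neg, map_neg, hx], ?_⟩
    rw [map_neg, hx', ← Finset.sum_neg_distrib]
    exact Finset.sum_congr rfl fun i _ => (map_neg _ _).symm
  add_mem' := by
    classical
    rintro a b ⟨S, s, h⟩ ⟨T, t, h'⟩
    refine ⟨S ∪ T,
      RelH.map 2 (pairIncl (Set.subset_univ _) (Set.subset_univ _)
        (K.sublink_mono Finset.subset_union_left) subset_rfl) s +
      RelH.map 2 (pairIncl (Set.subset_univ _) (Set.subset_univ _)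
        (K.sublink_mono Finset.subset_union_right) subset_rfl) t, fun S' hS r hr => ?_⟩
    obtain ⟨x, hx, hx'⟩ := h S' (Finset.subset_union_left.trans hS) r hr
    obtain ⟨y, hy, hy'⟩ := h' S' (Finset.subset_union_right.trans hS) r hr
    refine ⟨x + y, ?_, ?_⟩
    · rw [map_add, map_add, hx, hy, ← RelH.map_comp, ← RelH.map_comp, pairIncl_comp, pairIncl_comp]
    · rw [map_add, hx', hy', ← Finset.sum_add_distrib]
      exact Finset.sum_congr rfl fun i _ => (map_add _ _ _).symm

/-- The idele class group `𝒞 = 𝒥 / 𝒫`. -/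
abbrev IdeleClassGroup (K : TubedLink ι M) := K.ideleGroup ⧸ K.principalIdeles

/-- The map `⟨·⟩_i : H_1(∂V_i) → 𝒥`. -/
def embIdele (K : TubedLink ι M) (i : ι) : SingH 1 (K.torus i 1) →+ K.ideleGroup :=
  letI := Classical.decEq ι
  (AddMonoidHom.single (fun i => SingH 1 (K.torus i 1)) i).codRestrict K.ideleGroup fun a =>
    (Set.finite_singleton i).subset fun j hj => by
      by_contra h
      refine hj ?_
      rw [AddMonoidHom.single_apply, Pi.single_eq_of_ne h, map_zero]

/-- The map `⟨·⟩_i : H_1(∂V_i) → 𝒥 → 𝒞`. -/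
def embClass (K : TubedLink ι M) (i : ι) : SingH 1 (K.torus i 1) →+ K.IdeleClassGroup :=
  (QuotientAddGroup.mk' K.principalIdeles).comp (K.embIdele i)

lemma ideleToCompl_principal [T2Space M] (K : TubedLink ι M) (S : Finset ι) :
    K.principalIdeles ≤ (K.ideleToCompl S).ker := by
  classical
  rintro a ⟨T, t, h⟩
  let S' : Finset ι := (S ∪ T) ∪ a.2.toFinset
  have hS : S ⊆ S' := Finset.subset_union_left.trans Finset.subset_union_left
  have hT : T ⊆ S' := Finset.subset_union_right.trans Finset.subset_union_left
  obtain ⟨r, hr⟩ := K.exists_tubesDisjoint S'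
  obtain ⟨x, -, hx⟩ := h S' hT r hr
  have h0 := map_pairBoundary 1 (K.tori_subset_exterior hr) x
  rw [hx, map_sum] at h0
  have h1 := congrArg (SingH.map 1 (setIncl (K.exterior_subset_compl hS hr.1))) h0
  rw [map_sum, map_zero] at h1
  rw [AddMonoidHom.mem_ker]
  change ∑ᶠ i, K.toCompl S i (a.1 i) = 0
  rw [finsum_eq_sum_of_support_subset (s := S'), ← h1, ← Finset.sum_coe_sort S']
  · refine Finset.sum_congr rfl fun i _ => ?_
    rw [K.toCompl_eq (hr.isSmall i.2 hS)]
    have e : K.torusToCompl (hr.isSmall i.2 hS) = (setIncl (K.exterior_subset_compl hS hr.1)).comp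
        ((setIncl (K.tori_subset_exterior hr)).comp
          ((setIncl (Set.subset_biUnion_of_mem (u := fun i => K.torus i r) i.2)).comp
            (K.shrinkTorus i hr.1))) := rfl
    rw [e, SingH.map_comp]
    refine congrArg (SingH.map 1 (setIncl (K.exterior_subset_compl hS hr.1))) ?_
    exact DFunLike.congr_fun (SingH.map_comp 1 (setIncl (K.tori_subset_exterior hr)) _) _
  · intro i hi
    by_contra hi'
    simp only [S', Finset.coe_union, Set.mem_union, Finset.mem_coe, not_or] at hi'
    refine hi (K.toCompl_eq_zero hi'.1.1 ?_)
    by_contra h'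
    exact hi'.2 ((Set.Finite.mem_toFinset _).2 h')

/-- The homomorphism `𝒞 → H_1(M - 𝒦)` induced by `𝒥 → H_1(M - 𝒦)`. -/
def rhoClass [T2Space M] (K : TubedLink ι M) : K.IdeleClassGroup →+ K.H1Compl :=
  QuotientAddGroup.lift K.principalIdeles K.rho fun _ ha =>
    Subtype.ext (funext fun S => (AddMonoidHom.mem_ker).1 (K.ideleToCompl_principal S ha))

end TubedLink

/-! ## Branched covers and norm residue symbols -/

open TubedLink

variable {ι : Type*} {M N : Type} [TopologicalSpace M] [TopologicalSpace N]

/-- A finite cover `h : N → M` branched along the sublink `L` with index set `S`: a connected finite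
covering over `M - L`, which around each point over `L` has the form `(t, z) ↦ (t, z ^ e)` in
suitable charts, with `L` given by `z = 0`. -/
structure IsFiniteBranchedCover (K : TubedLink ι M) (S : Finset ι) (h : N → M) : Prop where
  continuous : Continuous h
  surjective : Function.Surjective h
  finite_fiber : ∀ x, (h ⁻¹' {x}).Finite
  isCoveringMapOn : IsCoveringMapOn h (K.compl S)
  isConnected : IsConnected (h ⁻¹' K.compl S)
  local_model : ∀ y, h y ∈ K.sublink S → ∃ (e : ℕ) (φ : OpenPartialHomeomorph N (ℝ × ℂ))
    (ψ : OpenPartialHomeomorph M (ℝ × ℂ)), 0 < e ∧ y ∈ φ.source ∧ Set.MapsTo h φ.source ψ.source ∧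
      (∀ x ∈ ψ.source, x ∈ K.sublink S ↔ (ψ x).2 = 0) ∧
      ∀ y' ∈ φ.source, ψ (h y') = ((φ y').1, (φ y').2 ^ e)

/-- A finite abelian branched cover: the group `Gal h` of covering transformations is transitive on
the fibres over `M - L`, and abelian. -/
structure IsFiniteAbelianBranchedCover (K : TubedLink ι M) (S : Finset ι) (h : N → M) : Prop
    extends IsFiniteBranchedCover K S h where
  exists_gal : ∀ y y', h y = h y' → h y ∈ K.compl S → ∃ g ∈ Gal h, g y = y'
  comm : ∀ f ∈ Gal h, ∀ g ∈ Gal h, f * g = g * f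

namespace IsFiniteAbelianBranchedCover

variable {K : TubedLink ι M} {S : Finset ι} {h : N → M}

/-- The group `Gal h`, as a commutative group. -/
@[reducible] def galCommGroup (hh : IsFiniteAbelianBranchedCover K S h) : CommGroup (Gal h) where
  mul_comm f g := Subtype.ext (hh.comm f f.2 g g.2)

lemma dense (hh : IsFiniteAbelianBranchedCover K S h) : Dense (h ⁻¹' K.compl S) := by
  rw [dense_iff_inter_open]
  rintro U hU ⟨y, hy⟩
  by_cases hyL : h y ∈ K.sublink S
  · obtain ⟨e, φ, ψ, he, hyφ, hmaps, hL, hform⟩ := hh.local_model y hyL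
    have hW : IsOpen (φ '' (φ.source ∩ U)) :=
      φ.isOpen_image_source_inter hU
    obtain ⟨⟨A, B⟩, ⟨hA, hB⟩, hAB⟩ : ∃ AB : Set ℝ × Set ℂ,
        (IsOpen AB.1 ∧ (φ y).1 ∈ AB.1 ∧ IsOpen AB.2 ∧ (φ y).2 ∈ AB.2) ∧
        AB.1 ×ˢ AB.2 ⊆ φ '' (φ.source ∩ U) ∧ True := by
      obtain ⟨A, B, hA, hB, h1, h2, h3⟩ := isOpen_prod_iff.1 hW (φ y).1 (φ y).2 ⟨y, ⟨hyφ, hy⟩, rfl⟩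
      exact ⟨(A, B), ⟨hA, h1, hB, h2⟩, h3, trivial⟩
    obtain ⟨z, hzB, hz0⟩ := (dense_compl_singleton (0 : ℂ)).inter_open_nonempty B hB.2.1
      ⟨_, hB.2.2⟩
    obtain ⟨y', ⟨hy'φ, hy'U⟩, hy'⟩ := hAB.1 (show ((φ y).1, z) ∈ A ×ˢ B from ⟨hB.1, hzB⟩)
    refine ⟨y', hy'U, fun hx => ?_⟩
    have h0 := (hL _ (hmaps hy'φ)).1 hx
    rw [hform y' hy'φ, hy'] at h0
    exact hz0 (pow_eq_zero_iff he.ne' |>.1 h0)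
  · exact ⟨y, hy, hyL⟩

lemma gal_eq [T2Space N] (hh : IsFiniteAbelianBranchedCover K S h) {f g : N ≃ₜ N} (hf : f ∈ Gal h)
    (hg : g ∈ Gal h) {y : N} (hy : h y ∈ K.compl S) (hfg : f y = g y) : f = g := by
  have hmaps : ∀ f ∈ Gal h, ∀ x : h ⁻¹' K.compl S, f x ∈ h ⁻¹' K.compl S := fun f hf x => by
    rw [Set.mem_preimage, hf]
    exact x.2
  have : PreconnectedSpace (h ⁻¹' K.compl S) :=
    Subtype.preconnectedSpace hh.isConnected.isPreconnected
  have key := hh.isCoveringMapOn.isCoveringMap_restrictPreimage.eq_of_comp_eq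
    (g₁ := fun x : h ⁻¹' K.compl S => (⟨f x, hmaps f hf x⟩ : h ⁻¹' K.compl S))
    (g₂ := fun x : h ⁻¹' K.compl S => (⟨g x, hmaps g hg x⟩ : h ⁻¹' K.compl S))
    (Continuous.subtype_mk (f.continuous.comp continuous_subtype_val) _)
    (Continuous.subtype_mk (g.continuous.comp continuous_subtype_val) _)
    (by
      funext x
      exact Subtype.ext ((hf x).trans (hg x).symm)) ⟨y, hy⟩ (Subtype.ext hfg)
  refine Homeomorph.ext (congrFun (Continuous.ext_on hh.dense f.continuous g.continuous ?_))
  intro x hx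
  exact congrArg Subtype.val (congrFun key ⟨x, hx⟩)

/-- The unbranched cover `N - h⁻¹(L) → M - L`. -/
abbrev unbranched (_ : IsFiniteAbelianBranchedCover K S h) : h ⁻¹' K.compl S → K.compl S :=
  (K.compl S).restrictPreimage h

/-- The action of `Gal h` on `N - h⁻¹(L)`. -/
def act (_ : IsFiniteAbelianBranchedCover K S h) :
    Gal h →* (↥(h ⁻¹' K.compl S) ≃ₜ ↥(h ⁻¹' K.compl S)) where
  toFun f := f.1.subtype fun x => by rw [Set.mem_preimage, Set.mem_preimage, f.2]
  map_one' := rfl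
  map_mul' _ _ := rfl

lemma isRegularCover [T2Space N] (hh : IsFiniteAbelianBranchedCover K S h) :
    IsRegularCover hh.unbranched hh.act where
  map_act g e := Subtype.ext (g.2 e)
  existsUnique_act e e' he := by
    obtain ⟨g, hg, hge⟩ := hh.exists_gal e e' (congrArg Subtype.val he) e.2
    refine ⟨⟨g, hg⟩, Subtype.ext hge, fun g' hg' => Subtype.ext ?_⟩
    exact hh.gal_eq g'.2 hg e.2 ((congrArg Subtype.val hg').trans hge.symm)
  existsUnique_lift n f a₀ e₀ he := by
    have : ContractibleSpace (stdSimplex ℝ (Fin (n + 1))) :=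
      (convex_stdSimplex ℝ _).contractibleSpace ⟨_, (stdSimplex.vertex (0 : Fin (n + 1))).2⟩
    have : LocallyPathConnectedSpace (stdSimplex ℝ (Fin (n + 1))) :=
      (convex_stdSimplex ℝ _).locallyPathConnectedSpace
    exact hh.isCoveringMapOn.isCoveringMap_restrictPreimage.existsUnique_continuousMap_lifts
      f a₀ e₀ he

/-- The homomorphism `H_1(M - L) → Gal h`. -/
def reciprocity [T2Space N] (hh : IsFiniteAbelianBranchedCover K S h) :
    SingH 1 (K.compl S) →+ Additive (Gal h) :=
  letI := hh.galCommGroup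
  hh.isRegularCover.holonomy

/-- The global norm residue symbol `(·, h) : 𝒞 → Gal h`, the composition
`𝒞 → H_1(M - 𝒦) → H_1(M - L) → Gal h`. -/
def globalSymbol [T2Space M] [T2Space N] (hh : IsFiniteAbelianBranchedCover K S h) :
    K.IdeleClassGroup →+ Additive (Gal h) :=
  hh.reciprocity.comp ((K.projCompl S).comp K.rhoClass)

end IsFiniteAbelianBranchedCover

/-- `W` is a connected component of the preimage under `h` of the torus of radius `r` around
`K_i`. -/
def IsTorusAbove (K : TubedLink ι M) (h : N → M) (i : ι) (r : ℝ) (W : Set N) : Prop :=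
  ∃ y ∈ h ⁻¹' K.torus i r, W = connectedComponentIn (h ⁻¹' K.torus i r) y

namespace IsTorusAbove

variable {K : TubedLink ι M} {S : Finset ι} {h : N → M} {i : ι} {r : ℝ} {W : Set N}

lemma subset (hW : IsTorusAbove K h i r W) : W ⊆ h ⁻¹' K.torus i r := by
  obtain ⟨y, hy, rfl⟩ := hW
  exact connectedComponentIn_subset _ _

lemma isPreconnected (hW : IsTorusAbove K h i r W) : IsPreconnected W := by
  obtain ⟨y, hy, rfl⟩ := hW
  exact isPreconnected_connectedComponentIn

lemma nonempty (hW : IsTorusAbove K h i r W) : W.Nonempty := by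
  obtain ⟨y, hy, rfl⟩ := hW
  exact ⟨y, mem_connectedComponentIn hy⟩

lemma subset_of_mem (hW : IsTorusAbove K h i r W) {A : Set N} (hA : IsPreconnected A)
    (hA' : A ⊆ h ⁻¹' K.torus i r) {y : N} (hyA : y ∈ A) (hyW : y ∈ W) : A ⊆ W := by
  obtain ⟨y₀, hy₀, rfl⟩ := hW
  rw [connectedComponentIn_eq hyW]
  exact hA.subset_connectedComponentIn hyA hA'

/-- The cover `h_K : W → ∂V_K`, the restriction of `h`. -/
def cover (hW : IsTorusAbove K h i r W) : W → K.torus i r := fun y => ⟨h y, hW.subset y.2⟩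

lemma mem_of_gal (hW : IsTorusAbove K h i r W) {f : N ≃ₜ N} (hf : f ∈ Gal h) {y : N} (hy : y ∈ W)
    (hfy : f y ∈ W) {x : N} (hx : x ∈ W) : f x ∈ W := by
  refine hW.subset_of_mem (A := f '' W) (hW.isPreconnected.image _ f.continuous.continuousOn) ?_
    ⟨y, hy, rfl⟩ hfy ⟨x, hx, rfl⟩
  rintro _ ⟨z, hz, rfl⟩
  rw [Set.mem_preimage, hf]
  exact hW.subset hz

lemma gal_eq (hW : IsTorusAbove K h i r W) (hh : IsFiniteAbelianBranchedCover K S h)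
    (hr : K.IsSmall S i r) {f g : W → N} (hf : Continuous f) (hg : Continuous g)
    (hf' : ∀ x, h (f x) = h x) (hg' : ∀ x, h (g x) = h x) {y : W} (hfg : f y = g y) : f = g := by
  have : PreconnectedSpace W := Subtype.preconnectedSpace hW.isPreconnected
  have hmem : ∀ x : W, h x ∈ K.compl S := fun x => K.torus_subset_compl hr (hW.subset x.2)
  have hfm : ∀ x, f x ∈ h ⁻¹' K.compl S := fun x => by
    rw [Set.mem_preimage, hf']
    exact hmem x
  have hgm : ∀ x, g x ∈ h ⁻¹' K.compl S := fun x => by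
    rw [Set.mem_preimage, hg']
    exact hmem x
  have key := hh.isCoveringMapOn.isCoveringMap_restrictPreimage.eq_of_comp_eq
    (g₁ := fun x : W => (⟨f x, hfm x⟩ : h ⁻¹' K.compl S))
    (g₂ := fun x : W => (⟨g x, hgm x⟩ : h ⁻¹' K.compl S))
    (Continuous.subtype_mk hf _) (Continuous.subtype_mk hg _)
    (by
      funext x
      exact Subtype.ext ((hf' x).trans (hg' x).symm)) y (Subtype.ext hfg)
  funext x
  exact congrArg Subtype.val (congrFun key x)

lemma exists_extension (hW : IsTorusAbove K h i r W) (hh : IsFiniteAbelianBranchedCover K S h)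
    (hr : K.IsSmall S i r) (f : Gal hW.cover) :
    ∃ F : Gal h, ∀ x : W, F.1 x = (f.1 x : N) := by
  obtain ⟨y, hy⟩ := hW.nonempty
  have hf : ∀ x : W, h (f.1 x : N) = h x := fun x => congrArg Subtype.val (f.2 x)
  obtain ⟨F, hF, hFy⟩ := hh.exists_gal y (f.1 ⟨y, hy⟩) (hf ⟨y, hy⟩).symm
    (K.torus_subset_compl hr (hW.subset hy))
  exact ⟨⟨F, hF⟩, congrFun (hW.gal_eq hh hr (F.continuous.comp continuous_subtype_val)
    (continuous_subtype_val.comp f.1.continuous) (fun x => hF x) hf (y := ⟨y, hy⟩) hFy)⟩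

/-- The natural map `Gal h_K → Gal h`: a covering transformation of `W` goes to the covering
transformation of `N` that extends it. -/
def toGal [T2Space N] (hW : IsTorusAbove K h i r W) (hh : IsFiniteAbelianBranchedCover K S h)
    (hr : K.IsSmall S i r) : Gal hW.cover →* Gal h where
  toFun f := (hW.exists_extension hh hr f).choose
  map_one' := by
    obtain ⟨y, hy⟩ := hW.nonempty
    exact Subtype.ext (hh.gal_eq (hW.exists_extension hh hr 1).choose.2 (one_mem _)
      (K.torus_subset_compl hr (hW.subset hy)) ((hW.exists_extension hh hr 1).choose_spec ⟨y, hy⟩))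
  map_mul' f g := by
    obtain ⟨y, hy⟩ := hW.nonempty
    refine Subtype.ext (hh.gal_eq (hW.exists_extension hh hr (f * g)).choose.2
      (mul_mem (hW.exists_extension hh hr f).choose.2 (hW.exists_extension hh hr g).choose.2)
      (K.torus_subset_compl hr (hW.subset hy))
      (((hW.exists_extension hh hr (f * g)).choose_spec ⟨y, hy⟩).trans ?_))
    change _ = (hW.exists_extension hh hr f).choose.1 ((hW.exists_extension hh hr g).choose.1 y)
    rw [(hW.exists_extension hh hr g).choose_spec ⟨y, hy⟩,
      (hW.exists_extension hh hr f).choose_spec]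
    rfl

lemma toGal_apply [T2Space N] (hW : IsTorusAbove K h i r W)
    (hh : IsFiniteAbelianBranchedCover K S h) (hr : K.IsSmall S i r) (f : Gal hW.cover) (x : W) :
    (hW.toGal hh hr f).1 x = (f.1 x : N) :=
  (hW.exists_extension hh hr f).choose_spec x

/-- The group `Gal h_K`, as a commutative group. -/
@[reducible] def galCommGroup [T2Space N] (hW : IsTorusAbove K h i r W)
    (hh : IsFiniteAbelianBranchedCover K S h) (hr : K.IsSmall S i r) :
    CommGroup (Gal hW.cover) where
  mul_comm f g := by
    have hinj : Function.Injective (hW.toGal hh hr) := fun f g hfg => by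
      refine Subtype.ext (Homeomorph.ext fun x => Subtype.ext ?_)
      rw [← hW.toGal_apply hh hr, ← hW.toGal_apply hh hr, hfg]
    refine hinj ?_
    rw [map_mul, map_mul]
    exact Subtype.ext (hh.comm _ (hW.toGal hh hr f).2 _ (hW.toGal hh hr g).2)

lemma isRegularCover (hW : IsTorusAbove K h i r W) (hh : IsFiniteAbelianBranchedCover K S h)
    (hr : K.IsSmall S i r) : IsRegularCover hW.cover (Gal hW.cover).subtype where
  map_act g e := g.2 e
  existsUnique_act e e' he := by
    obtain ⟨F, hF, hFe⟩ := hh.exists_gal e e' (congrArg Subtype.val he)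
      (K.torus_subset_compl hr (hW.subset e.2))
    have hFinv : F⁻¹ (e' : N) = e := by rw [← hFe, Homeomorph.inv_apply, F.symm_apply_apply]
    have hmem : ∀ x : N, x ∈ W ↔ F x ∈ W := fun x =>
      ⟨fun hx => hW.mem_of_gal hF e.2 (hFe ▸ e'.2) hx, fun hx => by
        have := hW.mem_of_gal (inv_mem hF) e'.2 (hFinv ▸ e.2) hx
        rwa [Homeomorph.inv_apply, F.symm_apply_apply] at this⟩
    refine ⟨⟨F.subtype hmem, fun x => Subtype.ext (hF x)⟩, Subtype.ext hFe, fun g hg => ?_⟩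
    refine Subtype.ext (Homeomorph.ext fun x => Subtype.ext ?_)
    exact congrFun (hW.gal_eq hh hr (f := fun x => (g.1 x : N)) (g := fun x => F x)
      (continuous_subtype_val.comp g.1.continuous) (F.continuous.comp continuous_subtype_val)
      (fun x => congrArg Subtype.val (g.2 x)) (fun x => hF x) (y := e)
      ((congrArg Subtype.val hg).trans hFe.symm)) x
  existsUnique_lift n f a₀ e₀ he := by
    have : ContractibleSpace (stdSimplex ℝ (Fin (n + 1))) :=
      (convex_stdSimplex ℝ _).contractibleSpace ⟨_, (stdSimplex.vertex (0 : Fin (n + 1))).2⟩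
    have : LocallyPathConnectedSpace (stdSimplex ℝ (Fin (n + 1))) :=
      (convex_stdSimplex ℝ _).locallyPathConnectedSpace
    obtain ⟨F, ⟨hF₀, hF⟩, huniq⟩ := hh.isCoveringMapOn.existsUnique_continuousMap_lifts
      (⟨fun t => (f t : M), continuous_subtype_val.comp f.continuous⟩ : C(_, M)) (a₀ := a₀)
      (e₀ := (e₀ : N)) (congrArg Subtype.val he)
      (fun t => K.torus_subset_compl hr (f t).2)
    have hFW : ∀ t, F t ∈ W := fun t =>
      hW.subset_of_mem (A := Set.range F) (isPreconnected_range F.continuous) (by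
        rintro _ ⟨s, rfl⟩
        have := congrFun hF s
        rw [Set.mem_preimage]
        exact (show h (F s) = f s from this) ▸ (f s).2) ⟨a₀, hF₀⟩ e₀.2 ⟨t, rfl⟩
    refine ⟨⟨fun t => ⟨F t, hFW t⟩, F.continuous.subtype_mk _⟩,
      ⟨Subtype.ext hF₀, funext fun t => Subtype.ext (congrFun hF t)⟩, ?_⟩
    rintro F' ⟨hF'₀, hF'⟩
    have := huniq ⟨fun t => (F' t : N), continuous_subtype_val.comp F'.continuous⟩
      ⟨congrArg Subtype.val hF'₀, funext fun t => congrArg Subtype.val (congrFun hF' t)⟩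
    ext t
    exact congrArg (fun G : C(_, N) => G t) this

/-- The local norm residue symbol `(·, h_K) : H_1(∂V_K) → Gal h_K`, where `∂V_K` is identified with
the torus of radius `r` around `K`. -/
def localSymbol [T2Space N] (hW : IsTorusAbove K h i r W) (hh : IsFiniteAbelianBranchedCover K S h)
    (hr : K.IsSmall S i r) : SingH 1 (K.torus i 1) →+ Additive (Gal hW.cover) :=
  letI := hW.galCommGroup hh hr
  (hW.isRegularCover hh hr).holonomy.comp (SingH.map 1 (K.shrinkTorus i hr.1))

end IsTorusAbove

end KnotIdele

end

open KnotIdele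

/-!
The diagram commutes because the homomorphism `H_1(X) → G` of a regular covering is natural. If a
map `F : E → E'` lies over `f : X → X'` and is equivariant for `φ : G → G'`, then `F` carries the
lift of a loop `γ` to a lift of `f ∘ γ`, so the covering transformation `g` with `e₁ = g e₀` at the
end points of the first lift gives `F(e₁) = φ(g) F(e₀)` at those of the second. This is
`IsRegularCover.holonomy_map`, and it is applied to the inclusion of the component `W` of
`h⁻¹(∂V_K)` into `N - h⁻¹(L)`, over the inclusion of the small torus into `M - L`; the map
`Gal h_K → Gal h`, given by extension of covering transformations, makes it equivariant.

In terms of singular chains, the homomorphism is defined by a cocycle `C_1(X) → G` that depends on a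
choice of a point `s(x)` in every fibre. The two cocycles on `X` to be compared (the pull-back of
that of `X'` and the image under `φ` of that of `X`) differ by the coboundary of the function `u`
that measures the difference between the choices, `F(s(x)) = u(x) · s'(f(x))`. Coboundaries vanish
on homology classes.

On the idele side, the image of `⟨a⟩_K` in `H_1(M - L)` is a sum over all components with a single
nonzero term, the image of `a` under `∂V_K → M - L` (`TubedLink.projCompl_rhoClass_embClass`).
-/

namespace KnotIdele

/-- A map of complexes compatible with two cocycles `α` and `β` up to a coboundary is compatible with
the maps that they induce on homology. -/
lemma homologyMap_homologyι_descOpcycles {V κ : Type*} [Category V] [Preadditive V]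
    [CategoryWithHomology V] {c : ComplexShape κ} {C D : HomologicalComplex V c} (f : C ⟶ D)
    (n n' m : κ) (hn : c.prev n = n') {A B : V} {α : C.X n ⟶ A} {β : D.X n ⟶ B} (φ : A ⟶ B)
    (u : C.X m ⟶ B) (hα : C.d n' n ≫ α = 0) (hβ : D.d n' n ≫ β = 0)
    (h : f.f n ≫ β = α ≫ φ + C.d n m ≫ u) :
    HomologicalComplex.homologyMap f n ≫ D.homologyι n ≫ D.descOpcycles β n' hn hβ =
      (C.homologyι n ≫ C.descOpcycles α n' hn hα) ≫ φ := by
  have h' : HomologicalComplex.opcyclesMap f n ≫ D.descOpcycles β n' hn hβ =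
      C.descOpcycles α n' hn hα ≫ φ + C.fromOpcycles n m ≫ u := by
    rw [← cancel_epi (C.pOpcycles n), HomologicalComplex.p_opcyclesMap_assoc,
      HomologicalComplex.p_descOpcycles, Preadditive.comp_add,
      HomologicalComplex.p_descOpcycles_assoc, HomologicalComplex.p_fromOpcycles_assoc, h]
  rw [HomologicalComplex.homologyι_naturality_assoc, h', Preadditive.comp_add,
    HomologicalComplex.homologyι_comp_fromOpcycles_assoc, zero_comp, add_zero, Category.assoc]

namespace IsRegularCover

variable {E X E' X' G G' : Type} [TopologicalSpace E] [TopologicalSpace X] [TopologicalSpace E']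
  [TopologicalSpace X']

/-- The total space of a regular covering maps onto a path connected base: lift paths that start at
a point of the image. -/
lemma surjective_of_pathConnectedSpace [Group G] [Nonempty E] [PathConnectedSpace X] {p : E → X}
    {act : G →* (E ≃ₜ E)} (hp : IsRegularCover p act) : Function.Surjective p := by
  intro x
  obtain ⟨e₀⟩ := ‹Nonempty E›
  let γ : Path (p e₀) x := (PathConnectedSpace.joined (p e₀) x).somePath
  let f : C(stdSimplex ℝ (Fin 2), X) := γ.toContinuousMap.comp
    ⟨stdSimplexHomeomorphUnitInterval, stdSimplexHomeomorphUnitInterval.continuous⟩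
  have hf : ∀ t : unitInterval, f (stdSimplexHomeomorphUnitInterval.symm t) = γ t := fun t =>
    congrArg γ (stdSimplexHomeomorphUnitInterval.apply_symm_apply t)
  obtain ⟨F, ⟨-, hF⟩, -⟩ := hp.existsUnique_lift 1 f (stdSimplexHomeomorphUnitInterval.symm 0) e₀
    ((hf 0).trans γ.source).symm
  exact ⟨F (stdSimplexHomeomorphUnitInterval.symm 1),
    (congrFun hF _).trans ((hf 1).trans γ.target)⟩

/-- The difference between the chosen points in the fibres of two coverings, along a map `F` of the
total spaces: the element `u(x) ∈ G'` with `F(s(x)) = u(x) · s'(p'(F(s(x))))`. -/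
noncomputable def sectionShift [Nonempty E] [Group G'] (p : E → X) {p' : E' → X'}
    {act' : G' →* (E' ≃ₜ E')} (hp' : IsRegularCover p' act') (F : C(E, E')) (x : X) : G' :=
  hp'.coord (F (Function.invFun p x))

lemma coord_map [Nonempty E] [Group G] [Group G'] {p : E → X} {act : G →* (E ≃ₜ E)}
    (hp : IsRegularCover p act) {p' : E' → X'} {act' : G' →* (E' ≃ₜ E')}
    (hp' : IsRegularCover p' act') (F : C(E, E')) (φ : G →* G')
    (hφ : ∀ g e, F (act g e) = act' (φ g) (F e)) (e : E) :
    hp'.coord (F e) = φ (hp.coord e) * hp'.sectionShift p F (p e) := by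
  conv_lhs => rw [← hp.act_coord e, hφ, hp'.coord_act]
  rfl

/-- The pull-back of the cocycle `edge` of `X'` and the image under `φ` of that of `X` differ by the
coboundary of `sectionShift`. Without surjectivity of `p`, a simplex outside its image would have the
value 0 for `X`, while its image in `X'` might lift. -/
lemma edge_map [Nonempty E] [CommGroup G] [CommGroup G'] {p : E → X} {act : G →* (E ≃ₜ E)}
    (hp : IsRegularCover p act) {p' : E' → X'} {act' : G' →* (E' ≃ₜ E')}
    (hp' : IsRegularCover p' act') (hsurj : Function.Surjective p) (f : C(X, X')) (F : C(E, E'))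
    (hF : ∀ e, p' (F e) = f (p e)) (φ : G →* G') (hφ : ∀ g e, F (act g e) = act' (φ g) (F e))
    (σ : C(stdSimplex ℝ (Fin 2), X)) :
    hp'.edge (f.comp σ) = MonoidHom.toAdditive φ (hp.edge σ) +
      (Additive.ofMul (hp'.sectionShift p F (σ (stdSimplex.vertex 1))) -
        Additive.ofMul (hp'.sectionShift p F (σ (stdSimplex.vertex 0)))) := by
  obtain ⟨e₀, he₀⟩ := hsurj (σ (stdSimplex.vertex 0))
  obtain ⟨T, ⟨-, hT⟩, -⟩ := hp.existsUnique_lift 1 σ (stdSimplex.vertex 0) e₀ he₀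
  have hT' : p' ∘ (F.comp T) = f.comp σ := by
    funext t
    exact (hF _).trans (congrArg f (congrFun hT t))
  have hv : ∀ t, p (T t) = σ t := congrFun hT
  rw [hp'.edge_eq _ hT', hp.edge_eq T hT]
  simp only [ContinuousMap.comp_apply, coord_map hp hp' F φ hφ, hv]
  change Additive.ofMul (_ / _) = Additive.ofMul (φ (_ / _) * (_ / _))
  rw [map_div φ]
  exact congrArg Additive.ofMul (mul_div_mul_comm _ _ _ _)

/-- The homomorphism `C_0(X) → G'` with the values `u` on points. -/
noncomputable def zeroChainHom [CommGroup G'] (u : X → G') :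
    ((TopCat.toSSet.obj (TopCat.of X)).chainComplex (AddCommGrpCat.of ℤ)).X 0 ⟶
      AddCommGrpCat.of (Additive G') :=
  Cofan.IsColimit.desc ((TopCat.toSSet.obj (TopCat.of X)).isColimitChainComplexXCofan
      (AddCommGrpCat.of ℤ) 0)
    (fun σ => AddCommGrpCat.ofHom (zmultiplesHom (Additive G')
      (Additive.ofMul (u ((TopCat.of X).toSSetObjEquiv _ σ (stdSimplex.vertex 0))))))

lemma ι_zeroChainHom [CommGroup G'] (u : X → G') (σ : (TopCat.toSSet.obj (TopCat.of X)) _⦋0⦌) :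
    (TopCat.toSSet.obj (TopCat.of X)).ιChainComplex (R := AddCommGrpCat.of ℤ) σ ≫
        zeroChainHom u = AddCommGrpCat.ofHom (zmultiplesHom (Additive G')
      (Additive.ofMul (u ((TopCat.of X).toSSetObjEquiv _ σ (stdSimplex.vertex 0))))) :=
  Cofan.IsColimit.fac ((TopCat.toSSet.obj (TopCat.of X)).isColimitChainComplexXCofan
      (AddCommGrpCat.of ℤ) 0) _ σ

lemma ι_chainHom [CommGroup G] {p : E → X} {act : G →* (E ≃ₜ E)} (hp : IsRegularCover p act)
    (σ : (TopCat.toSSet.obj (TopCat.of X)) _⦋1⦌) :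
    (TopCat.toSSet.obj (TopCat.of X)).ιChainComplex (R := AddCommGrpCat.of ℤ) σ ≫
        hp.chainHom = AddCommGrpCat.ofHom
      (zmultiplesHom (Additive G) (hp.edge ((TopCat.of X).toSSetObjEquiv _ σ))) :=
  Cofan.IsColimit.fac ((TopCat.toSSet.obj (TopCat.of X)).isColimitChainComplexXCofan
      (AddCommGrpCat.of ℤ) 1) _ σ

lemma map_chainHom [Nonempty E] [CommGroup G] [CommGroup G'] {p : E → X} {act : G →* (E ≃ₜ E)}
    (hp : IsRegularCover p act) {p' : E' → X'} {act' : G' →* (E' ≃ₜ E')}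
    (hp' : IsRegularCover p' act') (hsurj : Function.Surjective p) (f : C(X, X')) (F : C(E, E'))
    (hF : ∀ e, p' (F e) = f (p e)) (φ : G →* G') (hφ : ∀ g e, F (act g e) = act' (φ g) (F e)) :
    (SSet.chainComplexMap (TopCat.toSSet.map (TopCat.ofHom f)) (AddCommGrpCat.of ℤ)).f 1 ≫
        hp'.chainHom =
      hp.chainHom ≫ AddCommGrpCat.ofHom (MonoidHom.toAdditive φ) +
        ((TopCat.toSSet.obj (TopCat.of X)).chainComplex (AddCommGrpCat.of ℤ)).d 1 0 ≫
          zeroChainHom (hp'.sectionShift p F) := by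
  refine SSet.chainComplex_hom_ext (X := TopCat.toSSet.obj (TopCat.of X)) fun σ => ?_
  rw [SSet.ι_chainComplexMap_f_assoc, ι_chainHom, Preadditive.comp_add,
    reassoc_of% (ι_chainHom hp σ), SSet.ιChainComplex_d_assoc, Fin.sum_univ_two]
  simp only [Preadditive.add_comp, Preadditive.zsmul_comp, ι_zeroChainHom]
  refine AddCommGrpCat.hom_ext (AddMonoidHom.ext_int ?_)
  have key := edge_map hp hp' hsurj f F hF φ hφ ((TopCat.of X).toSSetObjEquiv _ σ)
  change hp'.edge ((TopCat.of X').toSSetObjEquiv _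
    ((TopCat.toSSet.map (TopCat.ofHom f)).app _ σ)) = _ at key
  have hface : ∀ i : Fin 2, (TopCat.of X).toSSetObjEquiv _
      ((TopCat.toSSet.obj (TopCat.of X)).δ i σ) (stdSimplex.vertex 0) =
      (TopCat.of X).toSSetObjEquiv _ σ (stdSimplex.vertex (Fin.succAbove i 0)) := fun i => by
    rw [← stdSimplex.map_vertex (S := ℝ) (Fin.succAbove i) 0]
    rfl
  have e0 : Fin.succAbove (0 : Fin 2) (0 : Fin 1) = 1 := rfl
  have e1 : Fin.succAbove (1 : Fin 2) (0 : Fin 1) = 0 := rfl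
  simp only [hface, e0, e1]
  simpa [sub_eq_add_neg] using key

/-- Naturality of the homomorphism `H_1(X) → G` of a regular covering. -/
theorem holonomy_map [Nonempty E] [CommGroup G] [CommGroup G'] {p : E → X} {act : G →* (E ≃ₜ E)}
    (hp : IsRegularCover p act) {p' : E' → X'} {act' : G' →* (E' ≃ₜ E')}
    (hp' : IsRegularCover p' act') (hsurj : Function.Surjective p) (f : C(X, X')) (F : C(E, E'))
    (hF : ∀ e, p' (F e) = f (p e)) (φ : G →* G') (hφ : ∀ g e, F (act g e) = act' (φ g) (F e))
    (a : SingH 1 X) :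
    hp'.holonomy (SingH.map 1 f a) = MonoidHom.toAdditive φ (hp.holonomy a) := by
  have key := homologyMap_homologyι_descOpcycles (singCx.map (TopCat.ofHom f)) 1 2 0 (by simp)
    (AddCommGrpCat.ofHom (MonoidHom.toAdditive φ)) (zeroChainHom (hp'.sectionShift p F))
    hp.d_chainHom hp'.d_chainHom (map_chainHom hp hp' hsurj f F hF φ hφ)
  exact congrArg (fun g => AddCommGrpCat.Hom.hom g a) key

end IsRegularCover

namespace TubedLink

variable {ι : Type*} {M : Type} [TopologicalSpace M]

lemma projCompl_rhoClass_embClass [T2Space M] (K : TubedLink ι M) (S : Finset ι) (i : ι)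
    (a : SingH 1 (K.torus i 1)) :
    K.projCompl S (K.rhoClass (K.embClass i a)) = K.toCompl S i a := by
  let := Classical.decEq ι
  change ∑ᶠ j, K.toCompl S j ((K.embIdele i a).1 j) = _
  have h : ∀ j, (K.embIdele i a).1 j = Pi.single (M := fun i => SingH 1 (K.torus i 1)) i a j :=
    fun _ => rfl
  rw [finsum_eq_single _ i fun j hj => by rw [h, Pi.single_eq_of_ne hj, map_zero], h,
    Pi.single_eq_same]

lemma pathConnectedSpace_torus (K : TubedLink ι M) (i : ι) {r : ℝ} (hr : 0 < r) :
    PathConnectedSpace (K.torus i r) := by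
  have e : K.torus i r =
      Set.range fun t : ℝ × ℝ => K.tube i (Circle.exp t.1, r * Circle.exp t.2) := by
    ext x
    constructor
    · rintro ⟨⟨u, z⟩, hz, rfl⟩
      have hz : ‖z‖ = r := hz
      refine ⟨(Complex.arg u, Complex.arg z), ?_⟩
      simp only [Circle.exp_arg, Circle.coe_exp]
      rw [← hz, Complex.norm_mul_exp_arg_mul_I]
    · rintro ⟨t, rfl⟩
      rw [tube_mem_torus, norm_mul, Circle.norm_coe, mul_one, Complex.norm_real,
        Real.norm_of_nonneg hr.le]
  rw [e]
  exact isPathConnected_iff_pathConnectedSpace.1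
    (isPathConnected_range ((K.isOpenEmbedding_tube i).continuous.comp (by fun_prop)))

end TubedLink

end KnotIdele

theorem mainTheorem4 {ι : Type*} [Countable ι] [Infinite ι] {M N : Type}
    [TopologicalSpace M] [T2Space M] [CompactSpace M] [ConnectedSpace M]
    [ChartedSpace (EuclideanSpace ℝ (Fin 3)) M]
    [TopologicalSpace N] [T2Space N] [CompactSpace N] [ConnectedSpace N]
    [ChartedSpace (EuclideanSpace ℝ (Fin 3)) N]
    (hM : IsRationalHomologySphere M) (K : TubedLink ι M) (hK : K.IsAdmissible)
    (S : Finset ι) (h : N → M) (hh : IsFiniteAbelianBranchedCover K S h)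
    (i : ι) (r : ℝ) (hr : K.IsSmall S i r) (W : Set N) (hW : IsTorusAbove K h i r W) :
    (MonoidHom.toAdditive (hW.toGal hh hr)).comp (hW.localSymbol hh hr) =
      hh.globalSymbol.comp (K.embClass i) := by
  refine AddMonoidHom.ext fun a => ?_
  have : Nonempty W := hW.nonempty.to_subtype
  have := K.pathConnectedSpace_torus i hr.1
  let := hW.galCommGroup hh hr
  let := hh.galCommGroup
  -- The inclusion of `W` into `N - h⁻¹(L)`, a map of coverings over the inclusion of the torus.
  let F : C(W, h ⁻¹' K.compl S) :=
    setIncl fun _ hy => K.torus_subset_compl hr (hW.subset hy)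
  have nat := IsRegularCover.holonomy_map (hW.isRegularCover hh hr) hh.isRegularCover
    (hW.isRegularCover hh hr).surjective_of_pathConnectedSpace
    (setIncl (K.torus_subset_compl hr)) F (fun _ => rfl) (hW.toGal hh hr)
    (fun g e => Subtype.ext (hW.toGal_apply hh hr g e).symm) (SingH.map 1 (K.shrinkTorus i hr.1) a)
  change MonoidHom.toAdditive (hW.toGal hh hr) ((hW.isRegularCover hh hr).holonomy _) =
    hh.isRegularCover.holonomy (K.projCompl S (K.rhoClass (K.embClass i a)))
  rw [K.projCompl_rhoClass_embClass, K.toCompl_eq hr, TubedLink.torusToCompl, SingH.map_comp]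
  exact nat.symm
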